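/- Let $G$ be a finite simple connected planar graph, and suppose that $G$ has a two-outerpath decomposition: for some embedding of $G$ in the plane, the set of faces (including the outer face) can be partitioned into two parts, each of which induces a path in the dual multigraph of the embedding. Here the dual multigraph has one vertex for each face and, for each edge $e$ of $G$, one edge joining the faces on the two sides of $e$; a path has at least one vertex, and an induced path has no loops and no parallel edges. (Equivalently, the edges of $G$ crossed by the dual edges between the two parts form a Hamiltonian cycle that splits $G$ into two outerpaths, where an outerpath is an outerplanar graph whose weak dual, the adjacency graph of its bounded faces, is a path.) Then the $2$-blowup of $G$ is biplanar. Here the $2$-blowup of $G$ is the graph with two copies $v_0, v_1$ of each vertex $v$ of $G$, in which two vertices are adjacent if and only if they are copies of adjacent vertices of $G$ (so $v_0$ and $v_1$ are not adjacent), and a graph is biplanar if its edges can be partitioned between two planar subgraphs. -/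

import Mathlib

namespace OuterpathBlowup

/-! ### Plane embeddings of connected graphs, their faces and their duals -/

/-- A rotation system of a simple graph: a permutation of the darts (oriented edges) that
cyclically orders the darts leaving each vertex, as met counterclockwise around the vertex. -/
structure RotationSystem {V : Type*} (G : SimpleGraph V) where
  next : Equiv.Perm G.Dart
  next_fst : ∀ d : G.Dart, (next d).fst = d.fst
  sameCycle_of_fst_eq : ∀ d d' : G.Dart, d.fst = d'.fst → next.SameCycle d d'

/-- The face permutation. It takes a dart from `u` to `v` to the dart that leaves `v` next after
the dart from `v` back to `u`, so that iterating it traces the boundary walk of a face. -/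
def RotationSystem.facePerm {V : Type*} {G : SimpleGraph V} (R : RotationSystem G) :
    Equiv.Perm G.Dart :=
  (SimpleGraph.Dart.symm_involutive (G := G)).toPerm.trans R.next

/-- The faces (of a graph with at least one edge): the cycles of the face permutation. -/
def RotationSystem.Face {V : Type*} {G : SimpleGraph V} (R : RotationSystem G) : Type _ :=
  Quotient (Equiv.Perm.SameCycle.setoid R.facePerm)

/-- The face on whose boundary walk a dart lies. The two sides of an edge are the faces of its
two darts. -/
def RotationSystem.faceOf {V : Type*} {G : SimpleGraph V} (R : RotationSystem G) (d : G.Dart) :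
    R.Face :=
  Quotient.mk (Equiv.Perm.SameCycle.setoid R.facePerm) d

/-- The dual multigraph: its vertices are the faces, its edges are the edges of `G`, and the edge
`e` joins the faces on the two sides of `e` (a loop when these coincide). -/
def RotationSystem.dual {V : Type*} {G : SimpleGraph V} (R : RotationSystem G) :
    Graph R.Face (Sym2 V) where
  vertexSet := Set.univ
  edgeSet := G.edgeSet
  IsLink e f g := ∃ d : G.Dart, d.edge = e ∧ R.faceOf d = f ∧ R.faceOf d.symm = g
  isLink_symm := by
    intro e _
    constructor
    rintro f g ⟨d, rfl, rfl, rfl⟩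
    exact ⟨d.symm, by simp, rfl, by simp⟩
  eq_or_eq_of_isLink_of_isLink := by
    rintro e f g f' g' ⟨d, rfl, rfl, rfl⟩ ⟨d', h, rfl, rfl⟩
    rcases (SimpleGraph.dart_edge_eq_iff d' d).1 h with rfl | rfl
    · exact Or.inl rfl
    · exact Or.inr (by simp)
  edge_mem_iff_exists_isLink := by
    intro e
    constructor
    · intro he
      induction e using Sym2.ind with
      | _ u v => exact ⟨_, _, ⟨(u, v), he⟩, rfl, rfl, rfl⟩
    · rintro ⟨f, g, d, rfl, -, -⟩
      exact d.edge_mem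
  left_mem_of_isLink := by
    intro e f g _
    exact Set.mem_univ f

/-- An embedding in the plane (equivalently in the sphere, all faces being treated alike) of a
finite connected graph with at least one edge, up to homeomorphism: a rotation system of Euler
genus zero. -/
structure PlaneEmbedding {V : Type*} (G : SimpleGraph V) extends RotationSystem G where
  connected : G.Connected
  euler : Nat.card V + Nat.card toRotationSystem.Face = Nat.card G.edgeSet + 2

/-- The multigraph `P` is a path: its vertices are the distinct `f 0, …, f n`, where `n` may be
`0`, and its edges are exactly `n` edges, one from `f i` to `f (i + 1)` for each `i < n`. In
particular there are no loops and no parallel edges. -/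
def IsPathMultigraph {α β : Type*} (P : Graph α β) : Prop :=
  ∃ (n : ℕ) (f : Fin (n + 1) → α) (e : Fin n → β),
    Function.Injective f ∧ Set.range f = P.vertexSet ∧ Set.range e = P.edgeSet ∧
      ∀ i : Fin n, P.IsLink (e i) (f i.castSucc) (f i.succ)

/-- A two-outerpath decomposition of a planar graph `G`: a plane embedding of `G` together with a
partition of its faces into two parts, each of which induces a path in the dual multigraph. -/
def HasTwoOuterpathDecomposition {V : Type*} (G : SimpleGraph V) : Prop :=
  ∃ (R : PlaneEmbedding G) (S : Set R.Face),
    IsPathMultigraph (R.dual.induce S) ∧ IsPathMultigraph (R.dual.induce Sᶜ)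

/-! ### Planar drawings, biplanarity and blowups -/

/-- A planar drawing: distinct points of the plane for the vertices and, for every edge, a simple
arc between its two ends that passes through no other vertex, such that two arcs meet only in
common ends. -/
structure PlanarDrawing {V : Type*} (G : SimpleGraph V) where
  pos : V → EuclideanSpace ℝ (Fin 2)
  pos_injective : Function.Injective pos
  arc : Sym2 V → Set (EuclideanSpace ℝ (Fin 2))
  exists_path : ∀ u v : V, G.Adj u v →
    ∃ γ : Path (pos u) (pos v), Function.Injective γ ∧ Set.range γ = arc s(u, v)
  mem_of_pos_mem : ∀ e ∈ G.edgeSet, ∀ w : V, pos w ∈ arc e → w ∈ e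
  inter_subset : ∀ e ∈ G.edgeSet, ∀ e' ∈ G.edgeSet, e ≠ e' →
    ∀ p ∈ arc e ∩ arc e', ∃ w : V, w ∈ e ∧ w ∈ e' ∧ pos w = p

/-- A graph is planar if it has a planar drawing. -/
def IsPlanar {V : Type*} (G : SimpleGraph V) : Prop :=
  Nonempty (PlanarDrawing G)

/-- A graph is biplanar (has thickness at most two) if its edges can be partitioned between two
planar subgraphs, which are drawn in separate planes. -/
def IsBiplanar {V : Type*} (G : SimpleGraph V) : Prop :=
  ∃ H₁ H₂ : SimpleGraph V, H₁ ⊔ H₂ = G ∧ Disjoint H₁ H₂ ∧ IsPlanar H₁ ∧ IsPlanar H₂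

/-- The (open) `k`-blowup of `G`: `k` copies `(v, 0), …, (v, k - 1)` of each vertex `v`, two copies
being adjacent exactly when they are copies of adjacent vertices of `G`. -/
def blowup {V : Type*} (k : ℕ) (G : SimpleGraph V) : SimpleGraph (V × Fin k) where
  Adj p q := G.Adj p.1 q.1
  symm := ⟨fun _ _ h => G.adj_symm h⟩
  loopless := ⟨fun p h => G.loopless.irrefl p.1 h⟩

end OuterpathBlowup

/-!
Let the faces of `G` be split into two induced dual paths `S` and `Sᶜ`. By Euler's formula exactly
`|V|` edges separate the two parts, and every vertex is on one of them, as the faces around a vertex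
would otherwise give a closed trail in a dual path (`exists_boundaryDart`). Gluing the faces
`f 0, …, f n` of `S` one after the other along their common edges shows that the boundary of their
union consists of two walks, starting at the two ends of a boundary edge of `f 0`, such that each
common edge joins the current ends of the two walks (`FacePath.exists_walks`). As these walks pass
through all vertices, counting shows that no vertex is repeated. So the edges touching `S` form a
strip: two sequences `x₀, x₁, …` and `y₀, y₁, …` that together list the vertices, edges between
consecutive vertices of one sequence, and pairwise non-crossing edges from one to the other, which
include all edges inside `S` (`FacePath.exists_stripLabelling`). The same holds for `Sᶜ`.

Put the two copies of `xᵢ` at `(±(i + 1), 0)` and those of `yⱼ` at `(0, ±(j + 1))`. Then all four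
copies of each crossing edge can be drawn as segments, one in each quadrant, together with the two
sign-preserving copies of each edge along a sequence (`StripLabelling.isPlanar`). The first planar
graph is the one drawn in this way for the strip of `S`. What remains are all copies of the edges
inside `Sᶜ` and the two copies `u₀v₁` and `u₁v₀` of those boundary edges `uv` that run along a
sequence of the strip of `S`. Exchanging the copies of every second vertex of each of these
sequences turns the latter into sign-preserving copies, so the remainder can be drawn in the same
way for the strip of `Sᶜ` (`isBiplanar_blowup_of_stripLabelling`).
-/

namespace OuterpathBlowup

/-! ### Straight-line drawings with vertices on the coordinate axes -/

theorem isPlanar_of_segments {W : Type*} (H : SimpleGraph W) (pos : W → EuclideanSpace ℝ (Fin 2))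
    (hpos : Function.Injective pos)
    (hmem : ∀ u v w : W, H.Adj u v → pos w ∈ segment ℝ (pos u) (pos v) → w ∈ s(u, v))
    (hinter : ∀ u v u' v' : W, H.Adj u v → H.Adj u' v' → s(u, v) ≠ s(u', v') →
      ∀ p, p ∈ segment ℝ (pos u) (pos v) → p ∈ segment ℝ (pos u') (pos v') →
        ∃ w, w ∈ s(u, v) ∧ w ∈ s(u', v') ∧ pos w = p) :
    IsPlanar H := by
  refine ⟨⟨pos, hpos, Sym2.lift ⟨fun u v => segment ℝ (pos u) (pos v),
    fun u v => segment_symm ℝ _ _⟩, ?_, ?_, ?_⟩⟩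
  · intro u v huv
    have hne : pos u ≠ pos v := fun h => huv.ne (hpos h)
    refine ⟨⟨⟨fun t => AffineMap.lineMap (pos u) (pos v) (t : ℝ), ?_⟩, ?_, ?_⟩, ?_, ?_⟩
    · exact AffineMap.lineMap_continuous.comp continuous_subtype_val
    · simp
    · simp
    · exact (AffineMap.lineMap_injective ℝ hne).comp Subtype.val_injective
    · simp only [Sym2.lift_mk, segment_eq_image_lineMap]
      ext p
      constructor
      · rintro ⟨t, rfl⟩
        exact ⟨t, t.2, rfl⟩
      · rintro ⟨t, ht, rfl⟩
        exact ⟨⟨t, ht⟩, rfl⟩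
  · intro e he w hw
    induction e using Sym2.ind with
    | _ u v => exact hmem u v w he hw
  · intro e he e' he' hne p hp
    induction e using Sym2.ind with
    | _ u v =>
      induction e' using Sym2.ind with
      | _ u' v' => exact hinter u v u' v' he he' hne p hp.1 hp.2

/-- The point at signed distance `z` from the origin on the first coordinate axis if `b` holds, and
on the second one otherwise. -/
noncomputable def axisPoint (b : Bool) (z : ℤ) : EuclideanSpace ℝ (Fin 2) :=
  if b then !₂[(z : ℝ), 0] else !₂[0, (z : ℝ)]

/-- Two segments from one half-axis to another that are nested do not meet, and segments sharing
one end meet only there. -/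
theorem slanted_inter {x y s s' : ℝ} {a b a' b' : ℤ} (ha : a ≠ 0) (hb : b ≠ 0)
    (hs : 0 ≤ s) (hs1 : s ≤ 1) (hs' : 0 ≤ s') (hs1' : s' ≤ 1)
    (hx : x = a * s) (hy : y = b * (1 - s)) (hx' : x = a' * s') (hy' : y = b' * (1 - s'))
    (ha' : a' ≠ 0) (hb' : b' ≠ 0)
    (h : |a| < |a'| → |b| ≤ |b'|) (h' : |a'| < |a| → |b'| ≤ |b|) :
    (a = a' ∧ x = a ∧ y = 0) ∨ (b = b' ∧ x = 0 ∧ y = b) ∨ (a = a' ∧ b = b') := by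
  have haR : (a : ℝ) ≠ 0 := by exact_mod_cast ha
  have hbR : (b : ℝ) ≠ 0 := by exact_mod_cast hb
  have haR' : (a' : ℝ) ≠ 0 := by exact_mod_cast ha'
  have hbR' : (b' : ℝ) ≠ 0 := by exact_mod_cast hb'
  by_cases haa : a = a'
  · subst haa
    have hss : s = s' := mul_left_cancel₀ haR (hx.symm.trans hx')
    subst hss
    by_cases h1 : s = 1
    · left; subst h1; simp [hx, hy]
    · right; right
      refine ⟨rfl, ?_⟩
      have : (b : ℝ) = b' :=
        mul_right_cancel₀ (sub_ne_zero.2 (Ne.symm h1)) (hy.symm.trans hy')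
      exact_mod_cast this
  by_cases hbb : b = b'
  · subst hbb
    have hss : 1 - s = 1 - s' := mul_left_cancel₀ hbR (hy.symm.trans hy')
    have hss : s = s' := by linarith
    subst hss
    by_cases h0 : s = 0
    · right; left; subst h0; simp [hx, hy]
    · exfalso
      apply haa
      have : (a : ℝ) = a' := mul_right_cancel₀ h0 (hx.symm.trans hx')
      exact_mod_cast this
  exfalso
  -- Both coordinates of a common point are nonzero, so both segments lie in one quadrant.
  have hs0 : 0 < s := by
    refine lt_of_le_of_ne hs fun h0 => hbb ?_
    have h1 : s' = 0 := by
      have : (a' : ℝ) * s' = 0 := by rw [← hx', hx, ← h0, mul_zero]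
      exact (mul_eq_zero.1 this).resolve_left haR'
    have : (b : ℝ) = b' := by
      have := hy.symm.trans hy'
      rw [← h0, h1] at this
      linarith
    exact_mod_cast this
  have hs1 : s < 1 := by
    refine lt_of_le_of_ne hs1 fun h0 => haa ?_
    have h1 : 1 - s' = 0 := by
      have : (b' : ℝ) * (1 - s') = 0 := by rw [← hy', hy, h0]; ring
      exact (mul_eq_zero.1 this).resolve_left hbR'
    have : (a : ℝ) = a' := by
      have := hx.symm.trans hx'
      rw [h0, show s' = 1 by linarith] at this
      linarith
    exact_mod_cast this
  have ea : |(a : ℝ)| * s = |(a' : ℝ)| * s' := by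
    have e := congrArg abs (hx.symm.trans hx')
    rwa [abs_mul, abs_mul, abs_of_nonneg hs, abs_of_nonneg hs'] at e
  have eb : |(b : ℝ)| * (1 - s) = |(b' : ℝ)| * (1 - s') := by
    have e := congrArg abs (hy.symm.trans hy')
    rwa [abs_mul, abs_mul, abs_of_nonneg (sub_nonneg.2 hs1.le), abs_of_nonneg (sub_nonneg.2 hs1')]
      at e
  have pa : 0 < |(a : ℝ)| := abs_pos.2 haR
  have pb : 0 < |(b : ℝ)| := abs_pos.2 hbR
  have pa' : 0 < |(a' : ℝ)| := abs_pos.2 haR'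
  have pb' : 0 < |(b' : ℝ)| := abs_pos.2 hbR'
  rcases lt_trichotomy |a| |a'| with hlt | heq | hlt
  · have h2 := h hlt
    have hltR : |(a : ℝ)| < |(a' : ℝ)| := by exact_mod_cast hlt
    have h2R : |(b : ℝ)| ≤ |(b' : ℝ)| := by exact_mod_cast h2
    have : s' < s := by nlinarith
    nlinarith
  · have heR : |(a : ℝ)| = |(a' : ℝ)| := by exact_mod_cast heq
    have hss : s = s' := mul_left_cancel₀ pa.ne' (ea.trans (by rw [heR]))
    subst hss
    exact haa (by exact_mod_cast mul_right_cancel₀ hs0.ne' (hx.symm.trans hx'))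
  · have h2 := h' hlt
    have hltR : |(a' : ℝ)| < |(a : ℝ)| := by exact_mod_cast hlt
    have h2R : |(b' : ℝ)| ≤ |(b : ℝ)| := by exact_mod_cast h2
    have : s < s' := by nlinarith
    nlinarith

/-- A segment from one axis to the other meets a unit segment on the first axis that has integral
ends and avoids the origin only in an end of both. -/
theorem slanted_axis_inter {x y s : ℝ} {a b c d : ℤ} (hb : b ≠ 0)
    (hx : x = a * s) (hy : y = b * (1 - s)) (hy' : y = 0) (hd : d = c + 1)
    (hc : (c : ℝ) ≤ x) (hc' : x ≤ d) : x = a ∧ (a = c ∨ a = d) := by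
  have hbR : (b : ℝ) ≠ 0 := by exact_mod_cast hb
  have h1 : 1 - s = 0 := (mul_eq_zero.1 (hy.symm.trans hy')).resolve_left hbR
  have hxa : x = a := by rw [hx, show s = 1 by linarith, mul_one]
  refine ⟨hxa, ?_⟩
  rw [hxa] at hc hc'
  norm_cast at hc hc'
  omega

theorem axis_axis_inter {x : ℝ} {a b c d : ℤ} (hb : b = a + 1) (hd : d = c + 1)
    (ha : (a : ℝ) ≤ x) (ha' : x ≤ b) (hc : (c : ℝ) ≤ x) (hc' : x ≤ d) (hne : a ≠ c) :
    (x = a ∧ a = d) ∨ (x = b ∧ b = c) := by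
  have h1 : (a : ℝ) ≤ d := ha.trans hc'
  have h2 : (c : ℝ) ≤ b := hc.trans ha'
  norm_cast at h1 h2
  rcases lt_or_gt_of_ne hne with h | h
  · have : b = c := by omega
    exact Or.inr ⟨le_antisymm ha' (by rw [this]; exact hc), this⟩
  · have : a = d := by omega
    exact Or.inl ⟨le_antisymm (by rw [this]; exact hc') ha, this⟩

/-- Put the vertices on integral points of the two coordinate axes, away from the origin, and draw
the edges as segments. -/
theorem isPlanar_of_axes {W : Type*} (H : SimpleGraph W) (side : W → Bool) (z : W → ℤ)
    (hinj : ∀ u v, side u = side v → z u = z v → u = v) (hz : ∀ w, z w ≠ 0)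
    (hsame : ∀ u v, H.Adj u v → side u = side v →
      0 < z u * z v ∧ (z v = z u + 1 ∨ z u = z v + 1))
    (hcross : ∀ u v u' v', H.Adj u v → H.Adj u' v' → side u = true → side v = false →
      side u' = true → side v' = false → |z u| < |z u'| → |z v| ≤ |z v'|) :
    IsPlanar H := by
  set pos : W → EuclideanSpace ℝ (Fin 2) := fun w => axisPoint (side w) (z w) with hposdef
  have pt : ∀ w, side w = true → ∀ p : EuclideanSpace ℝ (Fin 2),
      p 0 = z w → p 1 = 0 → pos w = p := by
    intro w hw p h0 h1
    ext i
    fin_cases i <;> simp [pos, axisPoint, hw, h0, h1]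
  have pf : ∀ w, side w = false → ∀ p : EuclideanSpace ℝ (Fin 2),
      p 0 = 0 → p 1 = z w → pos w = p := by
    intro w hw p h0 h1
    ext i
    fin_cases i <;> simp [pos, axisPoint, hw, h0, h1]
  -- The three kinds of edges, with their points in coordinates.
  have key : ∀ u v, H.Adj u v → ∀ p ∈ segment ℝ (pos u) (pos v),
      (∃ a b, H.Adj a b ∧ s(u, v) = s(a, b) ∧ side a = true ∧ side b = false ∧
        ∃ s : ℝ, 0 ≤ s ∧ s ≤ 1 ∧ p 0 = z a * s ∧ p 1 = z b * (1 - s)) ∨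
      (∃ a b, s(u, v) = s(a, b) ∧ side a = true ∧ side b = true ∧ 0 < z a * z b ∧
        z b = z a + 1 ∧ p 1 = 0 ∧ z a ≤ p 0 ∧ p 0 ≤ z b) ∨
      (∃ a b, s(u, v) = s(a, b) ∧ side a = false ∧ side b = false ∧ 0 < z a * z b ∧
        z b = z a + 1 ∧ p 0 = 0 ∧ z a ≤ p 1 ∧ p 1 ≤ z b) := by
    intro u v huv p hp
    obtain ⟨s, t, hs, ht, hst, rfl⟩ := hp
    obtain rfl : t = 1 - s := by linarith
    rcases hu : side u with _ | _ <;> rcases hv : side v with _ | _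
    · right; right
      obtain ⟨h0, h1 | h1⟩ := hsame u v huv (by rw [hu, hv])
      · refine ⟨u, v, rfl, hu, hv, h0, h1, ?_⟩
        simp [pos, axisPoint, hu, hv, h1]
        constructor <;> nlinarith
      · refine ⟨v, u, Sym2.eq_swap, hv, hu, by rwa [mul_comm], h1, ?_⟩
        simp [pos, axisPoint, hu, hv, h1]
        constructor <;> nlinarith
    · left
      refine ⟨v, u, huv.symm, Sym2.eq_swap, hv, hu, 1 - s, ht, by linarith, ?_⟩
      simp [pos, axisPoint, hu, hv, mul_comm]
    · left
      refine ⟨u, v, huv, rfl, hu, hv, s, hs, by linarith, ?_⟩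
      simp [pos, axisPoint, hu, hv, mul_comm]
    · right; left
      obtain ⟨h0, h1 | h1⟩ := hsame u v huv (by rw [hu, hv])
      · refine ⟨u, v, rfl, hu, hv, h0, h1, ?_⟩
        simp [pos, axisPoint, hu, hv, h1]
        constructor <;> nlinarith
      · refine ⟨v, u, Sym2.eq_swap, hv, hu, by rwa [mul_comm], h1, ?_⟩
        simp [pos, axisPoint, hu, hv, h1]
        constructor <;> nlinarith
  have pos_t : ∀ w, side w = true → pos w 0 = z w ∧ pos w 1 = 0 := by
    intro w hw; simp [pos, axisPoint, hw]
  have pos_f : ∀ w, side w = false → pos w 0 = 0 ∧ pos w 1 = z w := by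
    intro w hw; simp [pos, axisPoint, hw]
  have hzR : ∀ w, (z w : ℝ) ≠ 0 := fun w => by exact_mod_cast hz w
  -- A unit segment with integral ends of the same sign does not contain the origin.
  have nz : ∀ {a b : ℤ} {x : ℝ}, 0 < a * b → b = a + 1 → (a : ℝ) ≤ x → x ≤ b → x ≠ 0 := by
    rintro a b x hab rfl h1 h2 rfl
    norm_cast at h1 h2
    have : a = 0 ∨ a = -1 := by omega
    rcases this with rfl | rfl <;> simp at hab
  refine isPlanar_of_segments H pos ?_ ?_ ?_
  · intro u v huv
    rcases hu : side u with _ | _ <;> rcases hv : side v with _ | _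
    · exact hinj u v (by rw [hu, hv]) (by
        have := (pos_f u hu).2
        rw [huv, (pos_f v hv).2] at this
        exact Int.cast_injective (α := ℝ) this.symm)
    · have := (pos_f u hu).1; rw [huv, (pos_t v hv).1] at this; exact absurd this (hzR v)
    · have := (pos_t u hu).2; rw [huv, (pos_f v hv).2] at this; exact absurd this (hzR v)
    · exact hinj u v (by rw [hu, hv]) (by
        have := (pos_t u hu).1
        rw [huv, (pos_t v hv).1] at this
        exact Int.cast_injective (α := ℝ) this.symm)
  · intro u v w huv hw
    rcases key u v huv _ hw with ⟨a, b, hab, e, ha, hb, s, hs, hs1, hx, hy⟩ |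
      ⟨a, b, e, ha, hb, h0, h1, hy, hx, hx'⟩ | ⟨a, b, e, ha, hb, h0, h1, hx, hy, hy'⟩ <;> rw [e]
    · rcases hsw : side w with _ | _
      · rw [(pos_f w hsw).1] at hx
        rw [(pos_f w hsw).2] at hy
        have : s = 0 := (mul_eq_zero.1 hx.symm).resolve_left (hzR a)
        rw [this] at hy
        have : w = b := hinj w b (by rw [hsw, hb]) (by
          have : (z w : ℝ) = z b := by linarith
          exact_mod_cast this)
        simp [this]
      · rw [(pos_t w hsw).1] at hx
        rw [(pos_t w hsw).2] at hy
        have : 1 - s = 0 := (mul_eq_zero.1 hy.symm).resolve_left (hzR b)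
        rw [show s = 1 by linarith] at hx
        have : w = a := hinj w a (by rw [hsw, ha]) (by
          have : (z w : ℝ) = z a := by linarith
          exact_mod_cast this)
        simp [this]
    · rcases hsw : side w with _ | _
      · rw [(pos_f w hsw).2] at hy; exact absurd hy (hzR w)
      · rw [(pos_t w hsw).1] at hx hx'
        replace hx := Int.cast_le.1 hx
        replace hx' := Int.cast_le.1 hx'
        have : z w = z a ∨ z w = z b := by omega
        rcases this with h | h
        · simp [hinj w a (by rw [hsw, ha]) h]
        · simp [hinj w b (by rw [hsw, hb]) h]
    · rcases hsw : side w with _ | _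
      · rw [(pos_f w hsw).2] at hy hy'
        replace hy := Int.cast_le.1 hy
        replace hy' := Int.cast_le.1 hy'
        have : z w = z a ∨ z w = z b := by omega
        rcases this with h | h
        · simp [hinj w a (by rw [hsw, ha]) h]
        · simp [hinj w b (by rw [hsw, hb]) h]
      · rw [(pos_t w hsw).1] at hx; exact absurd hx (hzR w)
  · intro u v u' v' huv huv' hne p hp hp'
    rcases key u v huv _ hp with ⟨a, b, hab, e, ha, hb, s, hs, hs1, hx, hy⟩ |
      ⟨a, b, e, ha, hb, h0, h1, hy, hx, hx2⟩ | ⟨a, b, e, ha, hb, h0, h1, hx, hy, hy2⟩ <;>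
    rcases key u' v' huv' _ hp' with ⟨a', b', hab', e', ha', hb', s', hs', hs1', hx', hy'⟩ |
      ⟨a', b', e', ha', hb', h0', h1', hy', hx', hx2'⟩ |
      ⟨a', b', e', ha', hb', h0', h1', hx', hy', hy2'⟩ <;>
    rw [e, e'] at hne <;> rw [e, e']
    · rcases slanted_inter (hz a) (hz b) hs hs1 hs' hs1' hx hy hx' hy' (hz a') (hz b')
        (hcross a b a' b' hab hab' ha hb ha' hb') (hcross a' b' a b hab' hab ha' hb' ha hb)
        with ⟨h, hpx, hpy⟩ | ⟨h, hpx, hpy⟩ | ⟨h, h2⟩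
      · obtain rfl := hinj a a' (by rw [ha, ha']) h
        exact ⟨a, by simp, by simp, pt a ha p hpx hpy⟩
      · obtain rfl := hinj b b' (by rw [hb, hb']) h
        exact ⟨b, by simp, by simp, pf b hb p hpx hpy⟩
      · obtain rfl := hinj a a' (by rw [ha, ha']) h
        obtain rfl := hinj b b' (by rw [hb, hb']) h2
        exact absurd rfl hne
    · obtain ⟨h, h2⟩ := slanted_axis_inter (hz b) hx hy hy' h1' hx' hx2'
      refine ⟨a, by simp, ?_, pt a ha p h hy'⟩
      rcases h2 with h2 | h2
      · simp [hinj a a' (by rw [ha, ha']) h2]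
      · simp [hinj a b' (by rw [ha, hb']) h2]
    · obtain ⟨h, h2⟩ := slanted_axis_inter (s := 1 - s) (hz a) hy (by rw [hx]; ring) hx' h1' hy' hy2'
      refine ⟨b, by simp, ?_, pf b hb p hx' h⟩
      rcases h2 with h2 | h2
      · simp [hinj b a' (by rw [hb, ha']) h2]
      · simp [hinj b b' (by rw [hb, hb']) h2]
    · obtain ⟨h, h2⟩ := slanted_axis_inter (hz b') hx' hy' hy h1 hx hx2
      refine ⟨a', ?_, by simp, pt a' ha' p h hy⟩
      rcases h2 with h2 | h2
      · simp [hinj a' a (by rw [ha', ha]) h2]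
      · simp [hinj a' b (by rw [ha', hb]) h2]
    · have hne' : z a ≠ z a' := by
        intro h
        have hb2 := hinj b b' (by rw [hb, hb']) (by rw [h1, h1', h])
        have ha2 := hinj a a' (by rw [ha, ha']) h
        exact hne (by rw [ha2, hb2])
      rcases axis_axis_inter h1 h1' hx hx2 hx' hx2' hne' with ⟨h, h2⟩ | ⟨h, h2⟩
      · have := hinj a b' (by rw [ha, hb']) h2
        exact ⟨a, by simp, by simp [this], pt a ha p h hy⟩
      · have := hinj b a' (by rw [hb, ha']) h2
        exact ⟨b, by simp, by simp [this], pt b hb p h hy⟩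
    · exact absurd hx' (nz h0 h1 hx hx2)
    · obtain ⟨h, h2⟩ := slanted_axis_inter (s := 1 - s') (hz a') hy' (by rw [hx']; ring) hx h1 hy hy2
      refine ⟨b', ?_, by simp, pf b' hb' p hx h⟩
      rcases h2 with h2 | h2
      · simp [hinj b' a (by rw [hb', ha]) h2]
      · simp [hinj b' b (by rw [hb', hb]) h2]
    · exact absurd hy' (nz h0 h1 hy hy2)
    · have hne' : z a ≠ z a' := by
        intro h
        have hb2 := hinj b b' (by rw [hb, hb']) (by rw [h1, h1', h])
        have ha2 := hinj a a' (by rw [ha, ha']) h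
        exact hne (by rw [ha2, hb2])
      rcases axis_axis_inter h1 h1' hy hy2 hy' hy2' hne' with ⟨h, h2⟩ | ⟨h, h2⟩
      · have := hinj a b' (by rw [ha, hb']) h2
        exact ⟨a, by simp, by simp [this], pf a ha p hx h⟩
      · have := hinj b a' (by rw [hb, ha']) h2
        exact ⟨b, by simp, by simp [this], pf b hb p hx h⟩

/-! ### Boundary walks of faces -/

section Rotation

variable {V : Type*} {G : SimpleGraph V} (R : RotationSystem G)

theorem RotationSystem.facePerm_apply (d : G.Dart) : R.facePerm d = R.next d.symm := rfl

theorem RotationSystem.facePerm_fst (d : G.Dart) : (R.facePerm d).fst = d.snd :=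
  R.next_fst d.symm

theorem RotationSystem.facePerm_ne (d : G.Dart) : R.facePerm d ≠ d := fun h =>
  d.fst_ne_snd (by rw [← R.facePerm_fst d, h])

theorem RotationSystem.faceOf_eq_iff {d e : G.Dart} :
    R.faceOf d = R.faceOf e ↔ R.facePerm.SameCycle d e :=
  Quotient.eq (r := Equiv.Perm.SameCycle.setoid R.facePerm)

theorem RotationSystem.faceOf_facePerm (d : G.Dart) : R.faceOf (R.facePerm d) = R.faceOf d :=
  (R.faceOf_eq_iff.2 (Equiv.Perm.sameCycle_apply_right.2 (Equiv.Perm.SameCycle.refl _ _))).symm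

/-- The dart after `d` around its tail lies on the face to the other side of `d`. -/
theorem RotationSystem.faceOf_next (d : G.Dart) : R.faceOf (R.next d) = R.faceOf d.symm := by
  rw [← R.faceOf_facePerm d.symm, R.facePerm_apply, SimpleGraph.Dart.symm_symm]

theorem exists_walk_darts_eq (l : List G.Dart) (a b : G.Dart)
    (h : List.IsChain G.DartAdj (a :: (l ++ [b]))) :
    ∃ p : G.Walk a.snd b.fst, p.darts = l := by
  induction l generalizing a with
  | nil =>
    have h1 : a.snd = b.fst := by simpa [SimpleGraph.DartAdj] using h
    exact ⟨SimpleGraph.Walk.nil.copy rfl h1, by simp⟩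
  | cons t l ih =>
    rw [List.cons_append, List.isChain_cons_cons] at h
    obtain ⟨p, hp⟩ := ih t h.2
    have h1 : a.snd = t.fst := h.1
    refine ⟨(SimpleGraph.Walk.cons t.adj p).copy h1.symm rfl, ?_⟩
    simp [hp]

/-- Two darts on the boundary of a face cut the boundary walk into two walks. -/
theorem RotationSystem.exists_arcs [Finite V] (d e : G.Dart) (h : R.faceOf d = R.faceOf e)
    (hne : d ≠ e) :
    ∃ (p : G.Walk d.snd e.fst) (q : G.Walk e.snd d.fst), (p.darts ++ q.darts).Nodup ∧
      ∀ t, t ∈ p.darts ++ q.darts ↔ R.faceOf t = R.faceOf d ∧ t ≠ d ∧ t ≠ e := by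
  classical
  have : Finite G.Dart := Finite.of_injective _ SimpleGraph.Dart.toProd_injective
  have := Fintype.ofFinite G.Dart
  have hd : d ∈ R.facePerm.support := Equiv.Perm.mem_support.2 (R.facePerm_ne d)
  have hnd := Equiv.Perm.nodup_toList R.facePerm d
  have hmem : ∀ t, t ∈ R.facePerm.toList d ↔ R.faceOf t = R.faceOf d := fun t => by
    rw [Equiv.Perm.mem_toList_iff, ← R.faceOf_eq_iff]
    exact ⟨fun h => h.1.symm, fun h => ⟨h.symm, hd⟩⟩
  have hpos := Equiv.Perm.length_toList_pos_of_mem_support R.facePerm d hd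
  have hchain : List.IsChain G.DartAdj (R.facePerm.toList d ++ [d]) := by
    rw [List.isChain_iff_getElem]
    intro i hi
    have key : (R.facePerm.toList d ++ [d])[i + 1] = R.facePerm (R.facePerm.toList d ++ [d])[i] := by
      simp only [List.length_append, List.length_singleton] at hi
      rw [List.getElem_append_left (by omega : i < (R.facePerm.toList d).length),
        Equiv.Perm.getElem_toList]
      by_cases h1 : i + 1 < (R.facePerm.toList d).length
      · rw [List.getElem_append_left h1, Equiv.Perm.getElem_toList, pow_succ',
          Equiv.Perm.mul_apply]
      · have h2 : i + 1 = (R.facePerm.toList d).length := by omega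
        have h3 : (R.facePerm ^ (i + 1)) d = d := by
          rw [← Equiv.Perm.pow_mod_card_support_cycleOf_self_apply, h2, Equiv.Perm.length_toList,
            Nat.mod_self, pow_zero, Equiv.Perm.one_apply]
        rw [List.getElem_append_right (by omega), ← Equiv.Perm.mul_apply, ← pow_succ', h3]
        simp
    show (_ : G.Dart).snd = (_ : G.Dart).fst
    rw [key, R.facePerm_fst]
  obtain ⟨l, hl⟩ : ∃ l, R.facePerm.toList d = d :: l := by
    cases hl : R.facePerm.toList d with
    | nil => rw [hl] at hpos; simp at hpos
    | cons a l =>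
      have := Equiv.Perm.toList_getElem_zero R.facePerm d hd
      simp only [hl, List.getElem_cons_zero] at this
      exact ⟨l, by rw [this]⟩
  rw [hl] at hnd hmem hchain
  have he : e ∈ l := by
    have := (hmem e).2 h.symm
    exact (List.mem_cons.1 this).resolve_left hne.symm
  obtain ⟨α, β, rfl⟩ := List.append_of_mem he
  have h1 : List.IsChain G.DartAdj ((d :: (α ++ [e])) ++ (β ++ [d])) := by simpa using hchain
  have h2 : List.IsChain G.DartAdj ((d :: α) ++ (e :: (β ++ [d]))) := by simpa using hchain
  obtain ⟨p, hp⟩ := exists_walk_darts_eq α d e h1.left_of_append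
  obtain ⟨q, hq⟩ := exists_walk_darts_eq β e d h2.right_of_append
  refine ⟨p, q, ?_, fun t => ?_⟩
  · rw [hp, hq]
    exact (hnd.of_cons).sublist (List.Sublist.append_left (List.sublist_cons_self e β) α)
  · rw [hp, hq, ← hmem]
    simp only [List.nodup_cons, List.nodup_append, List.mem_append, List.mem_cons] at hnd ⊢
    grind

/-! ### Paths of faces -/

variable {R}

/-- A set `S` of faces that induces a path `f 0, …, f n` in the dual multigraph, in terms of darts:
`out k` lies on `f k` and, for `k < n`, crosses to `f (k + 1)`. The ends are treated like the inner
faces by a choice of one more dart each: `start` on `f 0` and `out n` on `f n`, which both cross to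
faces outside `S`. The values `out k` for `k > n` are irrelevant. -/
structure FacePath (R : RotationSystem G) (S : Set R.Face) (n : ℕ) where
  start : G.Dart
  out : ℕ → G.Dart
  faceOf_start : R.faceOf start = R.faceOf (out 0)
  start_ne : start ≠ out 0
  faceOf_out_succ : ∀ k < n, R.faceOf (out (k + 1)) = R.faceOf (out k).symm
  out_succ_ne : ∀ k < n, (out k).symm ≠ out (k + 1)
  faceOf_out_inj : ∀ j ≤ n, ∀ k ≤ n, R.faceOf (out j) = R.faceOf (out k) → j = k
  mem_iff : ∀ F, F ∈ S ↔ ∃ k ≤ n, R.faceOf (out k) = F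
  interior : ∀ t, R.faceOf t ∈ S → R.faceOf t.symm ∈ S → ∃ k < n, t = out k ∨ t = (out k).symm

theorem exists_facePath {S : Set R.Face} (h : IsPathMultigraph (R.dual.induce S)) :
    ∃ n, Nonempty (FacePath R S n) := by
  obtain ⟨n, f, e, hinj, hf, he, hlink⟩ := h
  have hS : ∀ F, F ∈ S ↔ ∃ i, f i = F := fun F => (Set.ext_iff.1 hf F).symm
  have hd : ∀ i : Fin n, ∃ d : G.Dart, d.edge = e i ∧ R.faceOf d = f i.castSucc ∧
      R.faceOf d.symm = f i.succ := fun i => (hlink i).1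
  choose d hde hd1 hd2 using hd
  have hint : ∀ t : G.Dart, R.faceOf t ∈ S → R.faceOf t.symm ∈ S →
      ∃ i, t = d i ∨ t = (d i).symm := by
    intro t h1 h2
    have : t.edge ∈ Set.range e := by
      rw [he, Graph.edgeSet_induce]
      exact ⟨_, _, ⟨t, rfl, rfl, rfl⟩, h1, h2⟩
    obtain ⟨i, hi⟩ := this
    exact ⟨i, (SimpleGraph.dart_edge_eq_iff _ _).1 (by rw [hde, hi])⟩
  rcases n with _ | n
  · obtain ⟨a, ha⟩ : ∃ a, R.faceOf a = f 0 := Quotient.exists_rep (f 0)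
    refine ⟨0, ⟨⟨R.facePerm a, fun _ => a, R.faceOf_facePerm a, R.facePerm_ne a, by simp, by simp,
      by omega, fun F => ?_, fun t h1 h2 => ?_⟩⟩⟩
    · rw [hS]
      constructor
      · rintro ⟨i, rfl⟩
        exact ⟨0, le_rfl, by rw [ha, Fin.fin_one_eq_zero i]⟩
      · rintro ⟨_, _, rfl⟩
        exact ⟨0, ha.symm⟩
    · obtain ⟨i, _⟩ := hint t h1 h2
      exact i.elim0
  · let out : ℕ → G.Dart := fun k =>
      if h : k < n + 1 then d ⟨k, h⟩ else R.facePerm (d (Fin.last n)).symm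
    have out_lt : ∀ k (h : k < n + 1), out k = d ⟨k, h⟩ := fun k h => dif_pos h
    have out_last : out (n + 1) = R.facePerm (d (Fin.last n)).symm := dif_neg (lt_irrefl _)
    have hout : ∀ k (h : k ≤ n + 1), R.faceOf (out k) = f ⟨k, by omega⟩ := by
      intro k h
      rcases h.lt_or_eq with h | rfl
      · rw [out_lt k h, hd1]; rfl
      · rw [out_last, R.faceOf_facePerm, hd2]; rfl
    refine ⟨n + 1, ⟨⟨R.facePerm (out 0), out, R.faceOf_facePerm _, R.facePerm_ne _, ?_, ?_, ?_, ?_,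
      ?_⟩⟩⟩
    · intro k hk
      rw [hout (k + 1) (by omega), out_lt k hk, hd2]; rfl
    · intro k hk
      rcases (show k + 1 ≤ n + 1 from hk).lt_or_eq with h | h
      · rw [out_lt k hk, out_lt _ h]
        intro heq
        have h1 := congrArg SimpleGraph.Dart.symm heq
        rw [SimpleGraph.Dart.symm_symm] at h1
        have h2 := hd1 ⟨k, hk⟩
        rw [h1, hd2] at h2
        have := congrArg Fin.val (hinj h2)
        simp only [Fin.val_succ, Fin.val_castSucc] at this
        omega
      · obtain rfl : k = n := by omega
        rw [out_last, out_lt k hk]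
        exact (R.facePerm_ne _).symm
    · intro j hj k hk h
      rw [hout j hj, hout k hk] at h
      exact congrArg Fin.val (hinj h)
    · intro F
      rw [hS]
      constructor
      · rintro ⟨i, rfl⟩
        exact ⟨i, by omega, hout i (by omega)⟩
      · rintro ⟨k, hk, rfl⟩
        exact ⟨_, (hout k hk).symm⟩
    · intro t h1 h2
      obtain ⟨i, hi⟩ := hint t h1 h2
      exact ⟨i, i.2, by rwa [out_lt i i.2]⟩

namespace FacePath

variable {S : Set R.Face} {n : ℕ} (P : FacePath R S n)

/-- The dart on the `k`-th face that crosses back to the face before it, or `start` for `k = 0`. -/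
def inn : ℕ → G.Dart
  | 0 => P.start
  | k + 1 => (P.out k).symm

theorem faceOf_inn {k : ℕ} (hk : k ≤ n) : R.faceOf (P.inn k) = R.faceOf (P.out k) := by
  cases k with
  | zero => exact P.faceOf_start
  | succ k => exact (P.faceOf_out_succ k hk).symm

theorem inn_ne_out {k : ℕ} (hk : k ≤ n) : P.inn k ≠ P.out k := by
  cases k with
  | zero => exact P.start_ne
  | succ k => exact P.out_succ_ne k hk

theorem faceOf_out_mem {k : ℕ} (hk : k ≤ n) : R.faceOf (P.out k) ∈ S :=
  (P.mem_iff _).2 ⟨k, hk, rfl⟩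

theorem interior' {t : G.Dart} (h1 : R.faceOf t ∈ S) (h2 : R.faceOf t.symm ∈ S) :
    ∃ k < n, t = P.out k ∨ t = P.inn (k + 1) :=
  P.interior t h1 h2

theorem faceOf_out_symm_mem {k : ℕ} (hk : k < n) : R.faceOf (P.out k).symm ∈ S := by
  rw [← P.faceOf_out_succ k hk]
  exact P.faceOf_out_mem hk

theorem ncard_eq (P : FacePath R S n) : S.ncard = n + 1 := by
  have : S = (fun k => R.faceOf (P.out k)) '' (Finset.range (n + 1) : Set ℕ) := by
    ext F
    rw [P.mem_iff]
    simp
  rw [this, Set.InjOn.ncard_image]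
  · simp
  · intro j hj k hk h
    simp only [Finset.coe_range, Set.mem_Iio] at hj hk
    exact P.faceOf_out_inj j (by omega) k (by omega) h

/-- The faces around a vertex do not all belong to a path of faces: at a face of least index the
path would be crossed twice through the same edge. -/
theorem exists_faceOf_notMem (P : FacePath R S n) (d₀ : G.Dart) :
    ∃ d : G.Dart, d.fst = d₀.fst ∧ R.faceOf d ∉ S := by
  classical
  by_contra! hall
  have hex : ∃ k, k ≤ n ∧ ∃ d : G.Dart, d.fst = d₀.fst ∧ R.faceOf (P.out k) = R.faceOf d := by
    obtain ⟨k, hk, h⟩ := (P.mem_iff _).1 (hall d₀ rfl)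
    exact ⟨k, hk, d₀, rfl, h⟩
  obtain ⟨hk, d, hd, hdk⟩ := Nat.find_spec hex
  have hmin := fun m => Nat.find_min (m := m) hex
  set k := Nat.find hex
  have hsymm : ∀ t : G.Dart, t.fst = d₀.fst → R.faceOf t.symm ∈ S := fun t ht => by
    rw [← R.faceOf_next]
    exact hall _ (by rw [R.next_fst, ht])
  obtain ⟨j, hj, h | h⟩ := P.interior' (hall d hd) (hsymm d hd)
  · rw [h] at hdk
    obtain rfl := P.faceOf_out_inj _ hk _ hj.le hdk
    -- The dart before `d` around the vertex has the face of `d` on its other side.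
    have hd' : (R.next.symm d).fst = d₀.fst := by
      rw [← R.next_fst, Equiv.apply_symm_apply, hd]
    have hf : R.faceOf (R.next.symm d).symm = R.faceOf d := by
      rw [← R.faceOf_next, Equiv.apply_symm_apply]
    obtain ⟨i, hi, h' | h'⟩ := P.interior' (hall _ hd') (hsymm _ hd')
    · rw [h', h, ← P.faceOf_out_succ i hi] at hf
      have := P.faceOf_out_inj _ hi _ hk hf
      exact hmin i (by omega) ⟨hi.le, _, hd', by rw [h']⟩
    · have h'' : (R.next.symm d).symm = P.out i := by rw [h']; exact (P.out i).symm_symm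
      rw [h'', h] at hf
      have hik := P.faceOf_out_inj _ hi.le _ hk hf
      rw [hik, ← h] at h''
      have h3 : (R.next.symm d).snd = d.fst :=
        congrArg (fun t : G.Dart => t.fst) h''
      exact (R.next.symm d).fst_ne_snd (by rw [h3, hd', hd])
  · rw [h, P.faceOf_inn hj] at hdk
    have := P.faceOf_out_inj _ hk _ hj hdk
    refine hmin j (by omega) ⟨hj.le, R.next d, by rw [R.next_fst, hd], ?_⟩
    rw [R.faceOf_next, h]
    exact congrArg R.faceOf (P.out j).symm_symm.symm

end FacePath

/-- The darts with a face in `S` on their own side and a face outside `S` on the other one. -/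
def boundaryDarts (S : Set R.Face) : Set G.Dart :=
  {d | R.faceOf d ∈ S ∧ R.faceOf d.symm ∉ S}

theorem exists_boundaryDart [Finite V] {S : Set R.Face} {n m : ℕ} (P : FacePath R S n)
    (Q : FacePath R Sᶜ m) (d₀ : G.Dart) : ∃ d ∈ boundaryDarts S, d.fst = d₀.fst := by
  have : Finite G.Dart := Finite.of_injective _ SimpleGraph.Dart.toProd_injective
  by_contra! h
  obtain ⟨a, ha, haS⟩ := P.exists_faceOf_notMem d₀
  obtain ⟨b, hb, hbS⟩ := Q.exists_faceOf_notMem d₀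
  have hstep : ∀ k : ℕ, R.faceOf ((R.next ^ k) b) ∈ S ∧ ((R.next ^ k) b).fst = d₀.fst := by
    intro k
    induction k with
    | zero => exact ⟨by simpa using hbS, hb⟩
    | succ k ih =>
      rw [pow_succ', Equiv.Perm.mul_apply, R.next_fst, R.faceOf_next]
      refine ⟨?_, ih.2⟩
      by_contra hc
      exact h _ ⟨ih.1, hc⟩ ih.2
  obtain ⟨k, -, hk⟩ := (R.sameCycle_of_fst_eq b a (hb.trans ha.symm)).exists_pow_eq'
  exact haS (hk ▸ (hstep k).1)

end Rotation

/-! ### Strips from paths of faces -/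

section Strip

variable {V : Type*} {G : SimpleGraph V} {R : RotationSystem G} {S : Set R.Face} {n : ℕ}

theorem mem_darts_iff_getVert {u v : V} (p : G.Walk u v) (t : G.Dart) (ht : t ∈ p.darts) :
    ∃ i < p.length, t.fst = p.getVert i ∧ t.snd = p.getVert (i + 1) := by
  obtain ⟨i, hi, rfl⟩ := List.getElem_of_mem ht
  refine ⟨i, by simpa using hi, ?_⟩
  rw [SimpleGraph.Walk.darts_getElem_eq_getVert]
  exact ⟨rfl, rfl⟩

theorem getVert_append_of_le {u v w : V} (p : G.Walk u v) (q : G.Walk v w) {i : ℕ}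
    (hi : i ≤ p.length) : (p.append q).getVert i = p.getVert i := by
  rw [SimpleGraph.Walk.getVert_append]
  split_ifs with h
  · rfl
  · obtain rfl : i = p.length := by omega
    simp

/-- The boundary of the union of the faces before the `k`-th one of the path consists of two walks
that start at the ends of `P.start`. Each new face prolongs both, and the edge by which it is left
becomes a chord between their current ends, whence the chords are pairwise nested. -/
theorem FacePath.exists_walks [Finite V] (P : FacePath R S n) (k : ℕ) (hk : k ≤ n + 1) :
    ∃ (p : G.Walk (P.inn 0).snd (P.inn k).snd) (q : G.Walk (P.inn 0).fst (P.inn k).fst)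
      (C : Set (ℕ × ℕ)), IsChain (· ≤ ·) C ∧ (∀ c ∈ C, c.1 ≤ p.length ∧ c.2 ≤ q.length) ∧
      (∀ j ≤ k, ∃ c ∈ C, (P.inn j).edge = s(p.getVert c.1, q.getVert c.2)) ∧
      (∃ T : List G.Dart, T.Nodup ∧ T.length = p.length + q.length ∧
        ∀ t ∈ T, ∃ j < k, R.faceOf t = R.faceOf (P.out j) ∧ t ≠ P.inn j ∧ t ≠ P.out j) ∧
      ∀ j < k, ∀ t, R.faceOf t = R.faceOf (P.out j) → t ≠ P.inn j → t ≠ P.out j →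
        t ∈ p.darts ∨ t.symm ∈ q.darts := by
  induction k with
  | zero =>
    refine ⟨SimpleGraph.Walk.nil, SimpleGraph.Walk.nil, {(0, 0)}, by simp, by simp, ?_,
      ⟨[], by simp⟩, by simp⟩
    intro j hj
    obtain rfl : j = 0 := by omega
    exact ⟨(0, 0), rfl, Sym2.eq_swap⟩
  | succ k ih =>
    obtain ⟨p, q, C, hC, hle, hch, ⟨T, hT, hTl, hTm⟩, hcov⟩ := ih (by omega)
    have hkn : k ≤ n := by omega
    obtain ⟨a, b, hnd, hmem⟩ : ∃ (a : G.Walk (P.inn (k + 1)).fst (P.inn k).fst)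
        (b : G.Walk (P.inn k).snd (P.inn (k + 1)).snd), (a.darts ++ b.darts).Nodup ∧
        ∀ t, t ∈ a.darts ++ b.darts ↔
          R.faceOf t = R.faceOf (P.out k) ∧ t ≠ P.out k ∧ t ≠ P.inn k :=
      R.exists_arcs (P.out k) (P.inn k) (P.faceOf_inn hkn).symm (P.inn_ne_out hkn).symm
    have hle' : ∀ c ∈ C, c ≤ ((p.append b).length, (q.append a.reverse).length) := by
      intro c hc
      have := hle c hc
      rw [SimpleGraph.Walk.length_append, SimpleGraph.Walk.length_append]
      exact ⟨by show c.1 ≤ _; omega, by show c.2 ≤ _; omega⟩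
    refine ⟨p.append b, q.append a.reverse,
      insert ((p.append b).length, (q.append a.reverse).length) C,
      hC.insert fun c hc _ => Or.inr (hle' c hc), ?_, ?_, ⟨T ++ (a.darts ++ b.darts), ?_, ?_, ?_⟩, ?_⟩
    · rintro c (rfl | hc)
      · exact ⟨le_rfl, le_rfl⟩
      · exact hle' c hc
    · intro j hj
      rcases hj.lt_or_eq with hj | rfl
      · obtain ⟨c, hc, h⟩ := hch j (by omega)
        refine ⟨c, Or.inr hc, ?_⟩
        rw [h, getVert_append_of_le p b (hle c hc).1, getVert_append_of_le q _ (hle c hc).2]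
      · refine ⟨_, Or.inl rfl, ?_⟩
        rw [SimpleGraph.Walk.getVert_length, SimpleGraph.Walk.getVert_length]
        exact Sym2.eq_swap
    · refine List.Nodup.append hT hnd fun t h1 h2 => ?_
      obtain ⟨j, hj, h3, -⟩ := hTm t h1
      have := P.faceOf_out_inj j (by omega) k hkn (h3.symm.trans ((hmem t).1 h2).1)
      omega
    · simp only [List.length_append, SimpleGraph.Walk.length_darts, hTl,
        SimpleGraph.Walk.length_append, SimpleGraph.Walk.length_reverse]
      omega
    · intro t ht
      rcases List.mem_append.1 ht with ht | ht
      · obtain ⟨j, hj, h⟩ := hTm t ht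
        exact ⟨j, by omega, h⟩
      · obtain ⟨h1, h2, h3⟩ := (hmem t).1 ht
        exact ⟨k, by omega, h1, h3, h2⟩
    · intro j hj t h1 h2 h3
      rw [SimpleGraph.Walk.darts_append, SimpleGraph.Walk.darts_append, List.mem_append,
        List.mem_append]
      rcases (show j ≤ k by omega).lt_or_eq with hj | rfl
      · rcases hcov j hj t h1 h2 h3 with h | h
        · exact Or.inl (Or.inl h)
        · exact Or.inr (Or.inl h)
      · rcases List.mem_append.1 ((hmem t).2 ⟨h1, h3, h2⟩) with h | h
        · refine Or.inr (Or.inr ?_)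
          rw [SimpleGraph.Walk.darts_reverse]
          simpa using h
        · exact Or.inl (Or.inr h)

/-- A labelling of the vertices that lays out the edges in `E` as a strip: the vertices form two
sequences (the two values of `side`), ordered by `rank`; each edge joins consecutive vertices of one
of them or crosses between them, the latter being the case for all edges in `I`; and the crossing
edges do not cross one another. -/
structure StripLabelling {V : Type*} (E I : Set (Sym2 V)) where
  side : V → Bool
  rank : V → ℕ
  inj : ∀ u v, side u = side v → rank u = rank v → u = v
  consecutive : ∀ u v, s(u, v) ∈ E → side u = side v → rank v = rank u + 1 ∨ rank u = rank v + 1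
  side_ne : ∀ u v, s(u, v) ∈ I → side u ≠ side v
  mono : ∀ u v u' v', s(u, v) ∈ E → s(u', v') ∈ E → side u = true → side v = false →
    side u' = true → side v' = false → rank u < rank u' → rank v ≤ rank v'

/-- The edges with a side in `S`. -/
def touchingEdges (S : Set R.Face) : Set (Sym2 V) :=
  {e | ∃ d : G.Dart, d.edge = e ∧ R.faceOf d ∈ S}

/-- The edges with both sides in `S`. -/
def interiorEdges (S : Set R.Face) : Set (Sym2 V) :=
  {e | ∃ d : G.Dart, d.edge = e ∧ R.faceOf d ∈ S ∧ R.faceOf d.symm ∈ S}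

theorem FacePath.inn_zero_mem_boundaryDarts (P : FacePath R S n) :
    P.inn 0 ∈ boundaryDarts S := by
  have h0 : R.faceOf (P.inn 0) = R.faceOf (P.out 0) := P.faceOf_inn (Nat.zero_le n)
  have h1 : R.faceOf (P.inn 0) ∈ S := h0 ▸ P.faceOf_out_mem (Nat.zero_le n)
  refine ⟨h1, fun h2 => ?_⟩
  obtain ⟨i, hi, h | h⟩ := P.interior' h1 h2
  · rw [h] at h0
    have := P.faceOf_out_inj i hi.le 0 (Nat.zero_le n) h0
    exact P.inn_ne_out (Nat.zero_le n) (by rw [h, this])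
  · rw [h, P.faceOf_inn hi] at h0
    have := P.faceOf_out_inj (i + 1) hi 0 (Nat.zero_le n) h0
    omega

theorem FacePath.mem_boundaryDarts (P : FacePath R S n) {j : ℕ} (hj : j ≤ n) {t : G.Dart}
    (ht : R.faceOf t = R.faceOf (P.out j)) (h_in : t ≠ P.inn j) (h_out : t ≠ P.out j ∨ j = n) :
    t ∈ boundaryDarts S := by
  have h1 : R.faceOf t ∈ S := ht ▸ P.faceOf_out_mem hj
  refine ⟨h1, fun h2 => ?_⟩
  obtain ⟨i, hi, h | h⟩ := P.interior' h1 h2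
  · rw [h] at ht
    have := P.faceOf_out_inj i hi.le j hj ht
    rcases h_out with h' | h'
    · exact h' (by rw [h, this])
    · omega
  · rw [h, P.faceOf_inn hi] at ht
    have := P.faceOf_out_inj (i + 1) hi j hj ht
    exact h_in (by rw [h, this])

/-- A path of faces whose boundary passes through every vertex, with at most as many darts as there
are vertices, is laid out as a strip. -/
theorem FacePath.exists_stripLabelling [Finite V] (P : FacePath R S n)
    (hcov : ∀ v, ∃ d ∈ boundaryDarts S, d.fst = v)
    (hcard : (boundaryDarts S).ncard ≤ Nat.card V) :
    Nonempty (StripLabelling (touchingEdges S) (interiorEdges S)) := by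
  classical
  have : Finite G.Dart := Finite.of_injective _ SimpleGraph.Dart.toProd_injective
  have := Fintype.ofFinite V
  obtain ⟨p, q, C, hC, hle, hch, ⟨T, hT, hTl, hTm⟩, hpq⟩ := P.exists_walks (n + 1) le_rfl
  have hinn : ∀ j ≤ n, ∀ t, t = P.inn j ∨ t = P.out j →
      ∃ c ∈ C, t.edge = s(p.getVert c.1, q.getVert c.2) := by
    rintro j hj t (rfl | rfl)
    · exact hch j (by omega)
    · obtain ⟨c, hc, h⟩ := hch (j + 1) (by omega)
      exact ⟨c, hc, by rw [← h]; exact (P.out j).edge_symm.symm⟩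
  -- The two walks pass through all vertices,
  have hall : ∀ v, v ∈ p.support ++ q.support := by
    intro v
    obtain ⟨d, hd, rfl⟩ := hcov v
    obtain ⟨j, hj, hjd⟩ := (P.mem_iff _).1 hd.1
    rw [List.mem_append]
    by_cases h1 : d = P.inn j ∨ d = P.out j
    · obtain ⟨c, -, h⟩ := hinn j hj d h1
      have : d.fst ∈ d.edge := Sym2.mem_mk_left _ _
      rw [h] at this
      rcases Sym2.mem_iff.1 this with h | h <;> rw [h]
      · exact Or.inl (p.getVert_mem_support _)
      · exact Or.inr (q.getVert_mem_support _)
    · push Not at h1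
      rcases hpq j (by omega) d hjd.symm h1.1 h1.2 with h | h
      · exact Or.inl (p.dart_fst_mem_support_of_mem_darts h)
      · exact Or.inr (q.dart_snd_mem_support_of_mem_darts h)
  -- and counting shows that they do so only once.
  have hlen : T.length + 2 ≤ Nat.card V := by
    have hne : P.inn 0 ≠ P.out n := by
      intro h
      have h0 : R.faceOf (P.inn 0) = R.faceOf (P.out 0) := P.faceOf_inn (Nat.zero_le n)
      rw [h] at h0
      obtain rfl := P.faceOf_out_inj n le_rfl 0 (Nat.zero_le n) h0
      exact P.inn_ne_out le_rfl h
    have hT0 : P.inn 0 ∉ T := by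
      intro h
      obtain ⟨j, hj, h1, h2, -⟩ := hTm _ h
      rw [P.faceOf_inn (Nat.zero_le n)] at h1
      obtain rfl := P.faceOf_out_inj 0 (Nat.zero_le n) j (by omega) h1
      exact h2 rfl
    have hTn : P.out n ∉ T := by
      intro h
      obtain ⟨j, hj, h1, -, h2⟩ := hTm _ h
      obtain rfl := P.faceOf_out_inj n le_rfl j (by omega) h1
      exact h2 rfl
    have hnd : (P.inn 0 :: P.out n :: T).Nodup := by
      simp [hT, hT0, hTn, hne]
    calc T.length + 2 = (P.inn 0 :: P.out n :: T).toFinset.card := by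
          rw [List.toFinset_card_of_nodup hnd]; simp
      _ = ((P.inn 0 :: P.out n :: T).toFinset : Set G.Dart).ncard :=
          (Set.ncard_coe_finset _).symm
      _ ≤ (boundaryDarts S).ncard := by
          refine Set.ncard_le_ncard ?_ (Set.toFinite _)
          intro t ht
          rw [Finset.mem_coe, List.mem_toFinset, List.mem_cons, List.mem_cons] at ht
          rcases ht with rfl | rfl | ht
          · exact P.inn_zero_mem_boundaryDarts
          · exact P.mem_boundaryDarts le_rfl rfl (P.inn_ne_out le_rfl).symm (Or.inr rfl)
          · obtain ⟨j, hj, h1, h2, h3⟩ := hTm t ht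
            exact P.mem_boundaryDarts (by omega) h1 h2 (Or.inl h3)
      _ ≤ Nat.card V := hcard
  have hnodup : (p.support ++ q.support).Nodup := by
    have h1 : (p.support ++ q.support).toFinset = Finset.univ := by
      ext v; simpa using hall v
    have h2 := congrArg Finset.card h1
    rw [Finset.card_univ, ← Nat.card_eq_fintype_card, List.card_toFinset] at h2
    have h3 : (p.support ++ q.support).length ≤ (p.support ++ q.support).dedup.length := by
      rw [h2]
      simp only [List.length_append, SimpleGraph.Walk.length_support]
      omega
    rw [← List.dedup_eq_self]
    exact (List.dedup_sublist _).eq_of_length_le h3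
  obtain ⟨hp, hq, hdisj⟩ := List.nodup_append'.1 hnodup
  have idx : ∀ {a b : V} (w : G.Walk a b), w.support.Nodup → ∀ i ≤ w.length,
      w.support.idxOf (w.getVert i) = i := by
    intro a b w hw i hi
    have hi' : i < w.support.length := by rw [SimpleGraph.Walk.length_support]; omega
    rw [← SimpleGraph.Walk.support_getElem_eq_getVert (h := hi')]
    exact hw.idxOf_getElem i hi'
  let side : V → Bool := fun v => decide (v ∈ p.support)
  let rank : V → ℕ := fun v => if v ∈ p.support then p.support.idxOf v else q.support.idxOf v
  have side_p : ∀ i, side (p.getVert i) = true := fun i =>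
    decide_eq_true (p.getVert_mem_support i)
  have notMem : ∀ i, q.getVert i ∉ p.support := fun i h => hdisj h (q.getVert_mem_support i)
  have side_q : ∀ i, side (q.getVert i) = false := fun i => decide_eq_false (notMem i)
  have rank_p : ∀ i ≤ p.length, rank (p.getVert i) = i := fun i hi => by
    simp only [rank, if_pos (p.getVert_mem_support i)]
    exact idx p hp i hi
  have rank_q : ∀ i ≤ q.length, rank (q.getVert i) = i := fun i hi => by
    simp only [rank, if_neg (notMem i)]
    exact idx q hq i hi
  have classify : ∀ e ∈ touchingEdges S,
      (∃ u v, e = s(u, v) ∧ side u = side v ∧ rank v = rank u + 1) ∨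
        ∃ c ∈ C, e = s(p.getVert c.1, q.getVert c.2) := by
    rintro _ ⟨d, rfl, hd⟩
    obtain ⟨j, hj, hjd⟩ := (P.mem_iff _).1 hd
    by_cases h1 : d = P.inn j ∨ d = P.out j
    · exact Or.inr (hinn j hj d h1)
    · push Not at h1
      left
      rcases hpq j (by omega) d hjd.symm h1.1 h1.2 with h | h
      · obtain ⟨i, hi, h2, h3⟩ := mem_darts_iff_getVert p d h
        refine ⟨d.fst, d.snd, rfl, ?_, ?_⟩
        · rw [h2, h3, side_p, side_p]
        · rw [h2, h3, rank_p _ hi.le, rank_p _ hi]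
      · obtain ⟨i, hi, h2, h3⟩ := mem_darts_iff_getVert q d.symm h
        refine ⟨d.symm.fst, d.symm.snd, Sym2.eq_swap, ?_, ?_⟩
        · rw [h2, h3, side_q, side_q]
        · rw [h2, h3, rank_q _ hi.le, rank_q _ hi]
  have crossing : ∀ u v, s(u, v) ∈ touchingEdges S → side u = true → side v = false →
      ∃ c ∈ C, rank u = c.1 ∧ rank v = c.2 := by
    intro u v he hu hv
    rcases classify _ he with ⟨a, b, h, hab, -⟩ | ⟨c, hc, h⟩
    · rcases Sym2.eq_iff.1 h with ⟨rfl, rfl⟩ | ⟨rfl, rfl⟩ <;> simp [hu, hv] at hab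
    · rcases Sym2.eq_iff.1 h with ⟨rfl, rfl⟩ | ⟨rfl, rfl⟩
      · exact ⟨c, hc, rank_p _ (hle c hc).1, rank_q _ (hle c hc).2⟩
      · rw [side_q] at hu; cases hu
  refine ⟨⟨side, rank, ?_, ?_, ?_, ?_⟩⟩
  · intro u v hs hr
    by_cases hu : u ∈ p.support
    · have hv : v ∈ p.support := by
        have : side u = true := decide_eq_true hu
        rw [hs] at this
        exact of_decide_eq_true this
      simp only [rank, if_pos hu, if_pos hv] at hr
      exact (List.idxOf_inj hu).1 hr
    · have hv : v ∉ p.support := by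
        have : side u = false := decide_eq_false hu
        rw [hs] at this
        exact of_decide_eq_false this
      simp only [rank, if_neg hu, if_neg hv] at hr
      exact (List.idxOf_inj ((List.mem_append.1 (hall u)).resolve_left hu)).1 hr
  · intro u v he hs
    rcases classify _ he with ⟨a, b, h, -, hab⟩ | ⟨c, hc, h⟩
    · rcases Sym2.eq_iff.1 h with ⟨rfl, rfl⟩ | ⟨rfl, rfl⟩
      · exact Or.inl hab
      · exact Or.inr hab
    · rcases Sym2.eq_iff.1 h with ⟨rfl, rfl⟩ | ⟨rfl, rfl⟩ <;> simp [side_p, side_q] at hs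
  · rintro u v ⟨d, hd, h1, h2⟩ hs
    obtain ⟨i, hi, h⟩ := P.interior d h1 h2
    have : ∃ c ∈ C, d.edge = s(p.getVert c.1, q.getVert c.2) := by
      rcases h with rfl | rfl
      · exact hinn i hi.le _ (Or.inr rfl)
      · exact hinn (i + 1) hi _ (Or.inl rfl)
    obtain ⟨c, hc, h⟩ := this
    rw [hd] at h
    rcases Sym2.eq_iff.1 h with ⟨rfl, rfl⟩ | ⟨rfl, rfl⟩ <;> simp [side_p, side_q] at hs
  · intro u v u' v' he he' hu hv hu' hv' hlt
    obtain ⟨c, hc, h1, h2⟩ := crossing u v he hu hv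
    obtain ⟨c', hc', h1', h2'⟩ := crossing u' v' he' hu' hv'
    rw [h1, h1'] at hlt
    rw [h2, h2']
    rcases hC.total hc hc' with h | h
    · exact h.2
    · exact absurd h.1 (not_le.2 hlt)

/-- By Euler's formula, the darts from one of two complementary paths of faces to the other number
at most as many as the vertices. -/
theorem ncard_boundaryDarts_le [Finite V] {m : ℕ} (P : FacePath R S n) (Q : FacePath R Sᶜ m)
    (euler : Nat.card V + Nat.card R.Face = Nat.card G.edgeSet + 2) :
    (boundaryDarts S).ncard ≤ Nat.card V := by
  have : Finite G.Dart := Finite.of_injective _ SimpleGraph.Dart.toProd_injective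
  have : Finite R.Face := Quotient.finite _
  have hF : n + 1 + (m + 1) = Nat.card R.Face := by
    rw [← P.ncard_eq, ← Q.ncard_eq, Set.ncard_add_ncard_compl]
  let g : boundaryDarts S ⊕ (Fin n ⊕ Fin m) → G.edgeSet :=
    Sum.elim (fun d => ⟨d.1.edge, d.1.edge_mem⟩)
      (Sum.elim (fun i => ⟨(P.out i).edge, (P.out i).edge_mem⟩)
        fun i => ⟨(Q.out i).edge, (Q.out i).edge_mem⟩)
  have out_inj : ∀ {T : Set R.Face} {l : ℕ} (P : FacePath R T l) (i j : Fin l),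
      (P.out i).edge = (P.out j).edge → i = j := by
    intro T l P i j h
    rcases (SimpleGraph.dart_edge_eq_iff _ _).1 h with h | h
    · exact Fin.ext (P.faceOf_out_inj i i.2.le j j.2.le (by rw [h]))
    · have h1 := P.faceOf_out_inj i i.2.le (j + 1) j.2 (by rw [h, P.faceOf_out_succ j j.2])
      have h2 := P.faceOf_out_inj j j.2.le (i + 1) i.2
        (by rw [P.faceOf_out_succ i i.2, h, SimpleGraph.Dart.symm_symm])
      omega
  have hP : ∀ i : Fin n, R.faceOf (P.out i) ∈ S ∧ R.faceOf (P.out i).symm ∈ S := fun i =>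
    ⟨P.faceOf_out_mem i.2.le, P.faceOf_out_symm_mem i.2⟩
  have hQ : ∀ i : Fin m, R.faceOf (Q.out i) ∉ S ∧ R.faceOf (Q.out i).symm ∉ S := fun i =>
    ⟨Q.faceOf_out_mem i.2.le, Q.faceOf_out_symm_mem i.2⟩
  have key : ∀ {d e : G.Dart}, d.edge = e.edge →
      (R.faceOf d = R.faceOf e ∧ R.faceOf d.symm = R.faceOf e.symm ∧ d = e) ∨
        (R.faceOf d = R.faceOf e.symm ∧ R.faceOf d.symm = R.faceOf e) := by
    intro d e h
    rcases (SimpleGraph.dart_edge_eq_iff _ _).1 h with rfl | rfl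
    · exact Or.inl ⟨rfl, rfl, rfl⟩
    · exact Or.inr ⟨rfl, by rw [SimpleGraph.Dart.symm_symm]⟩
  have hg : Function.Injective g := by
    rintro (⟨d, hd⟩ | i | i) (⟨e, he⟩ | j | j) h <;>
      have h := congrArg Subtype.val h <;> simp only [g, Sum.elim_inl, Sum.elim_inr] at h
    · rcases key h with ⟨-, -, rfl⟩ | ⟨h1, -⟩
      · rfl
      · exact absurd (h1 ▸ hd.1) he.2
    · have := hP j; have h1 := hd.1; have h2 := hd.2
      rcases key h with ⟨e1, e2, -⟩ | ⟨e1, e2⟩ <;> rw [e2] at h2 <;> tauto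
    · have := hQ j; have h1 := hd.1; have h2 := hd.2
      rcases key h with ⟨e1, e2, -⟩ | ⟨e1, e2⟩ <;> rw [e1] at h1 <;> tauto
    · have := hP i; have h1 := he.1; have h2 := he.2
      rcases key h with ⟨e1, e2, -⟩ | ⟨e1, e2⟩ <;> rw [e1, e2] at this <;> tauto
    · rw [out_inj P i j h]
    · have := hP i; have h1 := hQ j
      rcases key h with ⟨e1, e2, -⟩ | ⟨e1, e2⟩ <;> rw [e1, e2] at this <;> tauto
    · have := hQ i; have h1 := he.1; have h2 := he.2
      rcases key h with ⟨e1, e2, -⟩ | ⟨e1, e2⟩ <;> rw [e1, e2] at this <;> tauto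
    · have := hQ i; have h1 := hP j
      rcases key h with ⟨e1, e2, -⟩ | ⟨e1, e2⟩ <;> rw [e1, e2] at this <;> tauto
    · rw [out_inj Q i j h]
  have := Nat.card_le_card_of_injective g hg
  rw [Nat.card_sum, Nat.card_sum, Nat.card_fin, Nat.card_fin, Nat.card_coe_set_eq] at this
  omega

end Strip

/-! ### Drawing the blowup -/

section Blowup

variable {V : Type*} {E I : Set (Sym2 V)}

/-- A graph on two copies of the vertices of a strip is planar if it only has copies of edges of the
strip and, for an edge along one of the two sequences, only the two copies that preserve a sign.
The two sequences go outwards along the coordinate axes, one copy of each vertex on either half. -/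
theorem StripLabelling.isPlanar (L : StripLabelling E I) (sign : V × Fin 2 → Bool)
    (hsign : ∀ v a b, sign (v, a) = sign (v, b) → a = b) (H : SimpleGraph (V × Fin 2))
    (hE : ∀ p q, H.Adj p q → s(p.1, q.1) ∈ E)
    (hH : ∀ p q, H.Adj p q → L.side p.1 = L.side q.1 → sign p = sign q) : IsPlanar H := by
  let z : V × Fin 2 → ℤ := fun p => if sign p then (L.rank p.1 + 1 : ℤ) else -(L.rank p.1 + 1 : ℤ)
  have hzabs : ∀ p, |z p| = L.rank p.1 + 1 := by
    intro p
    have : (0 : ℤ) ≤ L.rank p.1 + 1 := by positivity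
    simp only [z]
    split_ifs
    · exact abs_of_nonneg this
    · rw [abs_neg, abs_of_nonneg this]
  refine isPlanar_of_axes H (fun p => L.side p.1) z ?_ ?_ ?_ ?_
  · rintro ⟨u, a⟩ ⟨v, b⟩ hs hz
    have hr : L.rank u = L.rank v := by
      have := congrArg abs hz
      rw [hzabs, hzabs] at this
      simpa using this
    obtain rfl := L.inj u v hs hr
    rw [hsign u a b]
    simp only [z] at hz
    cases h1 : sign (u, a) <;> cases h2 : sign (u, b) <;> simp [h1, h2] at hz ⊢ <;> omega
  · intro p h
    have := hzabs p
    rw [h] at this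
    simp at this
    omega
  · intro p q hpq hs
    have h1 := hH p q hpq hs
    have h2 := L.consecutive p.1 q.1 (hE p q hpq) hs
    simp only [z, h1]
    split_ifs
    · exact ⟨by positivity, by omega⟩
    · exact ⟨by rw [neg_mul_neg]; positivity, by omega⟩
  · intro p q p' q' h h' hp hq hp' hq' hlt
    rw [hzabs, hzabs] at hlt ⊢
    have := L.mono p.1 q.1 p'.1 q'.1 (hE p q h) (hE p' q' h') hp hq hp' hq' (by omega)
    omega

/-- If the edges of `G` are covered by two strips, each of which leaves only crossing edges to
itself, then the `2`-blowup of `G` is biplanar. -/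
theorem isBiplanar_blowup_of_stripLabelling {G : SimpleGraph V} {E' I' : Set (Sym2 V)}
    (L : StripLabelling E I) (L' : StripLabelling E' I') (hEI' : G.edgeSet ⊆ E ∪ I')
    (hE'I : G.edgeSet ⊆ E' ∪ I) (hI' : I' ⊆ E') : IsBiplanar (blowup 2 G) := by
  let H : SimpleGraph (V × Fin 2) :=
    { Adj := fun p q => G.Adj p.1 q.1 ∧ s(p.1, q.1) ∈ E ∧ (L.side p.1 = L.side q.1 → p.2 = q.2)
      symm := ⟨fun p q h => ⟨h.1.symm, by rw [Sym2.eq_swap]; exact h.2.1,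
        fun hs => (h.2.2 hs.symm).symm⟩⟩
      loopless := ⟨fun p h => G.loopless.irrefl p.1 h.1⟩ }
  have hle : H ≤ blowup 2 G := fun p q h => h.1
  have hbeq : ∀ a b : Fin 2, (a == 0) = (b == 0) → a = b := by decide
  have hbne : ∀ a b : Fin 2, a ≠ b → (a == 0) = !(b == 0) := by decide
  refine ⟨H, blowup 2 G \ H, sup_sdiff_cancel_right hle, disjoint_sdiff_self_right, ?_, ?_⟩
  · exact L.isPlanar (fun p => p.2 == 0) (fun v a b h => hbeq a b h) H (fun p q h => h.2.1)
      fun p q h hs => by show (p.2 == 0) = (q.2 == 0); rw [h.2.2 hs]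
  -- An edge along the first strip has consecutive ranks there, so its two copies that remain
  -- preserve the sign once the copies of the vertices of odd rank are exchanged.
  · have hdiff : ∀ p q, (blowup 2 G \ H).Adj p q → s(p.1, q.1) ∈ I' ∨
        (s(p.1, q.1) ∈ E' ∧ L.side p.1 = L.side q.1 ∧ s(p.1, q.1) ∈ E ∧ p.2 ≠ q.2) := by
      intro p q h
      rw [SimpleGraph.sdiff_adj] at h
      have hG : G.Adj p.1 q.1 := h.1
      have hn : ¬ (G.Adj p.1 q.1 ∧ s(p.1, q.1) ∈ E ∧ (L.side p.1 = L.side q.1 → p.2 = q.2)) := h.2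
      rcases hEI' (show s(p.1, q.1) ∈ G.edgeSet from hG) with hE | hI
      · have : L.side p.1 = L.side q.1 ∧ p.2 ≠ q.2 := by tauto
        rcases hE'I (show s(p.1, q.1) ∈ G.edgeSet from hG) with hE' | hI
        · exact Or.inr ⟨hE', this.1, hE, this.2⟩
        · exact absurd this.1 (L.side_ne _ _ hI)
      · exact Or.inl hI
    refine L'.isPlanar (fun p => (p.2 == 0) ^^ (L.rank p.1).bodd) ?_ _ ?_ ?_
    · intro v a b h
      exact hbeq a b (by simpa using h)
    · intro p q h
      rcases hdiff p q h with h | h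
      · exact hI' h
      · exact h.1
    · intro p q h hs
      rcases hdiff p q h with h | ⟨-, h1, h2, h3⟩
      · exact absurd hs (L'.side_ne _ _ h)
      · show ((p.2 == 0) ^^ (L.rank p.1).bodd) = ((q.2 == 0) ^^ (L.rank q.1).bodd)
        rw [hbne _ _ h3]
        rcases L.consecutive _ _ h2 h1 with h | h <;> rw [h, Nat.bodd_succ] <;> simp

end Blowup

end OuterpathBlowup

open OuterpathBlowup in
theorem mainTheorem2 {V : Type*} [Finite V] (G : SimpleGraph V)
    (hG : OuterpathBlowup.HasTwoOuterpathDecomposition G) :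
    OuterpathBlowup.IsBiplanar (OuterpathBlowup.blowup 2 G) := by
  obtain ⟨R, S, hS, hS'⟩ := hG
  obtain ⟨n, ⟨P⟩⟩ := exists_facePath hS
  obtain ⟨m, ⟨Q⟩⟩ := exists_facePath hS'
  have hdart : ∀ v, ∃ d : G.Dart, d.fst = v := by
    intro v
    obtain ⟨w, hw⟩ : ∃ w, w ≠ v := by
      by_contra! h
      exact P.start.fst_ne_snd ((h _).trans (h _).symm)
    obtain ⟨p⟩ := R.connected v w
    cases p with
    | nil => exact absurd rfl hw
    | cons h _ => exact ⟨⟨(v, _), h⟩, rfl⟩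
  have hcov : ∀ v, ∃ d ∈ boundaryDarts S, d.fst = v := by
    intro v
    obtain ⟨d, rfl⟩ := hdart v
    exact exists_boundaryDart P Q d
  have Q' : FacePath R.toRotationSystem Sᶜᶜ n := (compl_compl S).symm ▸ P
  have hcov' : ∀ v, ∃ d ∈ boundaryDarts Sᶜ, d.fst = v := by
    intro v
    obtain ⟨d, rfl⟩ := hdart v
    exact exists_boundaryDart Q Q' d
  obtain ⟨L⟩ := P.exists_stripLabelling hcov (ncard_boundaryDarts_le P Q R.euler)
  obtain ⟨L'⟩ := Q.exists_stripLabelling hcov' (ncard_boundaryDarts_le Q Q' R.euler)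
  have hcases : ∀ e ∈ G.edgeSet, ∃ d : G.Dart, d.edge = e := by
    intro e he
    induction e using Sym2.ind with
    | _ u v => exact ⟨⟨(u, v), he⟩, rfl⟩
  refine isBiplanar_blowup_of_stripLabelling L L' ?_ ?_ ?_
  · intro e he
    obtain ⟨d, rfl⟩ := hcases e he
    by_cases h1 : R.faceOf d ∈ S
    · exact Or.inl ⟨d, rfl, h1⟩
    by_cases h2 : R.faceOf d.symm ∈ S
    · exact Or.inl ⟨d.symm, d.edge_symm, h2⟩
    exact Or.inr ⟨d, rfl, h1, h2⟩
  · intro e he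
    obtain ⟨d, rfl⟩ := hcases e he
    by_cases h1 : R.faceOf d ∈ S
    · by_cases h2 : R.faceOf d.symm ∈ S
      · exact Or.inr ⟨d, rfl, h1, h2⟩
      · exact Or.inl ⟨d.symm, d.edge_symm, h2⟩
    · exact Or.inl ⟨d, rfl, h1⟩
  · rintro e ⟨d, hd, h1, -⟩
    exact ⟨d, hd, h1⟩
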